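/- Work in $\mathbb{R}^2$ and let $B_r$ denote the open disk of radius $r$ centered at the origin. Let $G:\mathbb{R}^2\to[0,+\infty)$ be a radial kernel, i.e. $G(x)=g(|x|)$ for a.e. $x$ with some measurable $g:(0,+\infty)\to[0,+\infty)$, whose first moment is finite and normalized by $$\int_{\mathbb{R}^2}|x|\,G(x)\,dx=\frac{1}{\mathbf{K}_{1,2}},\qquad \mathbf{K}_{1,2}=\frac{1}{2\pi}\int_{\mathbb{S}^1}|\sigma\cdot\nu|\,d\mathscr{H}^1_\sigma\quad(\nu\in\mathbb{S}^1\text{ arbitrary}).$$ For $\varepsilon>0$ put $G_\varepsilon(x)=\varepsilon^{-3}G(\varepsilon^{-1}x)$, and let $\gamma\in(0,1)$. For $E\subseteq\mathbb{R}^2$ let $P(E)=\sup\{\int_E\operatorname{div}\varphi\,dx:\varphi\in C^1_c(\mathbb{R}^2;\mathbb{R}^2),\ |\varphi|\le 1\}$ be the perimeter, let $$\mathrm{Per}_{G_\varepsilon}(E)=2\iint_{E\times(\mathbb{R}^2\setminus E)}G_\varepsilon(x-y)\,dx\,dy$$ be the nonlocal perimeter, and let $\mathcal{F}_{\gamma,\varepsilon}(E)=P(E)-\gamma\,\mathrm{Per}_{G_\varepsilon}(E)$.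 Let $\delta:(0,+\infty)\to\mathbb{R}$ be any function with $\delta(\varepsilon)\to0$ as $\varepsilon\to0^+$. Then there exists $\bar\varepsilon_1>0$, depending only on $G$, $\gamma$ and $\delta$, such that the following holds for every $0<\varepsilon<\bar\varepsilon_1$. If $E\subseteq\mathbb{R}^2$ is a convex set with $$B_{1-\delta(\varepsilon)}\subseteq E\subseteq B_{1+\delta(\varepsilon)},$$ then for all $t\in(\tfrac12,1)$ the quantities $P(E)$, $\mathrm{Per}_{G_\varepsilon}(E)$, $P(tE)$, $\mathrm{Per}_{G_\varepsilon}(tE)$ are finite and $$\mathcal{F}_{\gamma,\varepsilon}(tE)<\mathcal{F}_{\gamma,\varepsilon}(E).$$ -/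

import Mathlib

open MeasureTheory Set Filter Topology
open scoped ENNReal Pointwise

noncomputable section

namespace LiquidDrop

/-- The Euclidean plane `ℝ²`. -/
abbrev Plane : Type := EuclideanSpace ℝ (Fin 2)

/-- The divergence of a vector field on the plane. -/
def divergence (φ : Plane → Plane) (x : Plane) : ℝ :=
  ∑ i : Fin 2, (fderiv ℝ φ x (EuclideanSpace.single i 1)) i

/-- The (De Giorgi) perimeter `P(E) = |D 1_E|(ℝ²)`: the supremum of `∫_E div φ` over all compactly
supported `C¹` vector fields `φ` with `|φ| ≤ 1`. -/
def perimeter (E : Set Plane) : ℝ≥0∞ :=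
  ⨆ (φ : Plane → Plane) (_ : ContDiff ℝ 1 φ) (_ : HasCompactSupport φ) (_ : ∀ x, ‖φ x‖ ≤ 1),
    ENNReal.ofReal (∫ x in E, divergence φ x)

/-- The nonlocal perimeter `Per_K(E) = 2 ∬_{E × Eᶜ} K(x - y) dx dy` of a kernel `K ≥ 0`. -/
def nonlocalPerimeter (K : Plane → ℝ) (E : Set Plane) : ℝ≥0∞ :=
  2 * ∫⁻ x in E, ∫⁻ y in Eᶜ, ENNReal.ofReal (K (x - y))

/-- The rescaled kernel `G_ε(x) = ε^{-(n+1)} G(x / ε)` in dimension `n = 2`. -/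
def rescaledKernel (G : Plane → ℝ) (ε : ℝ) (x : Plane) : ℝ :=
  (ε ^ 3)⁻¹ * G (ε⁻¹ • x)

/-- The constant `K_{1,2}`, the mean of `|σ · ν|` over `σ` in the unit circle with respect to its
arc length measure. By rotation invariance it does not depend on the unit vector `ν`; here `ν` is
the first vector of the canonical basis. -/
def meanAbsProjection : ℝ :=
  ⨍ σ : Metric.sphere (0 : Plane) 1,
    |inner ℝ (σ : Plane) (EuclideanSpace.single 0 1)| ∂(volume : Measure Plane).toSphere

/-- The standing assumptions on the kernel: `G` is nonnegative and radial (it coincides almost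
everywhere with `g(|x|)`, with `g : (0, ∞) → [0, ∞)` measurable; the values of `g` outside
`(0, ∞)` play no role), and its first moment is finite and equal to `1 / K_{1,2}`. -/
structure IsAdmissibleKernel (G : Plane → ℝ) : Prop where
  nonneg : ∀ x, 0 ≤ G x
  radial : ∃ g : ℝ → ℝ, Measurable g ∧ (∀ r, 0 < r → 0 ≤ g r) ∧
    ∀ᵐ x : Plane, G x = g ‖x‖
  integrable_moment : Integrable fun x : Plane => ‖x‖ * G x
  moment_eq : ∫ x : Plane, ‖x‖ * G x = 1 / meanAbsProjection

/-- The energy `F_{γ,ε}(E) = P(E) - γ Per_{G_ε}(E)`, meaningful for sets `E` for which both terms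
are finite. -/
def energy (G : Plane → ℝ) (γ ε : ℝ) (E : Set Plane) : ℝ :=
  (perimeter E).toReal - γ * (nonlocalPerimeter (rescaledKernel G ε) E).toReal

end LiquidDrop

end

noncomputable section

namespace LiquidDrop

/-! Both perimeters are compared along the dilation `t • E`, to first order in `1 - t`. The local
one gains at least `(1 - t) * P(E)` by scaling (`perimeter_smul_le`), and `P(E)` is nearly at least
`2π` since `E` almost fills the unit disk (`le_perimeter_of_ball_subset`).

The nonlocal perimeter is `2 ∫ K(z) |E \ (E + z)| dz` (`nonlocalPerimeter_eq`). Slicing a convex `E`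
into chords parallel to `z`, a chord of length `l` loses `min |z| l`, whereas the corresponding
chord of `t • E` contributes `t² min (|z|/t) l`. If `l ≥ |z|/t` the two differ by exactly `(1 -
t)|z|`, and in general by at most twice that. Chords occupy heights of total length about `2`, and
near a disk only those close to the top and bottom are short, so the drop in loss is about `2(1 -
t)|z|` for small `z`. Large `z` meet only the tail of the first moment of `G_ε`, which vanishes as
`ε → 0`. Since the full moment is `1 / K_{1,2} = π/2` (`meanAbsProjection_eq`), the nonlocal drop is
at most about `2π(1 - t)` (`nonlocalPerimeter_le_smul`). The factor `γ < 1` leaves a margin that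
absorbs all errors. -/

/-- The area of the part of `E` that leaves `E` under translation by `-z`. -/
def translateLoss (E : Set Plane) (z : Plane) : ℝ≥0∞ :=
  volume {x | x ∈ E ∧ x - z ∉ E}

/-- The length of the horizontal chord of `E` at height `y`. -/
def chordLength (E : Set Plane) (y : ℝ) : ℝ≥0∞ :=
  volume {a : ℝ | !₂[a, y] ∈ E}

/-! ### Translation losses through parallel chords -/

/-- A bounded open convex set of reals is an open interval. -/
lemma exists_eq_Ioo {I : Set ℝ} (hc : Convex ℝ I) (ho : IsOpen I) (hb : Bornology.IsBounded I) :
    ∃ a b : ℝ, I = Ioo a b := by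
  rcases I.eq_empty_or_nonempty with rfl | hne
  · exact ⟨0, 0, by simp⟩
  · refine ⟨sInf I, sSup I, Subset.antisymm (fun x hx => ?_) (fun x hx => ?_)⟩
    · have h1 : Icc (sInf I) (sSup I) ∈ 𝓝 x :=
        Filter.mem_of_superset (ho.mem_nhds hx)
          (fun y hy => ⟨csInf_le hb.bddBelow hy, le_csSup hb.bddAbove hy⟩)
      rw [← interior_Icc]
      exact mem_interior_iff_mem_nhds.2 h1
    · obtain ⟨u, hu, hux⟩ := exists_lt_of_csInf_lt hne hx.1
      obtain ⟨v, hv, hxv⟩ := exists_lt_of_lt_csSup hne hx.2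
      exact hc.ordConnected.out hu hv ⟨hux.le, hxv.le⟩

/-- A shift shorter than the interval uncovers an initial segment of length `s`; a longer one
uncovers everything. -/
lemma volume_translate_diff {I : Set ℝ} (hc : Convex ℝ I) (ho : IsOpen I)
    (hb : Bornology.IsBounded I) {s : ℝ} (hs : 0 ≤ s) :
    volume {x | x ∈ I ∧ x - s ∉ I} = min (ENNReal.ofReal s) (volume I) := by
  obtain ⟨a, b, rfl⟩ := exists_eq_Ioo hc ho hb
  rw [Real.volume_Ioo]
  rcases lt_or_ge s (b - a) with h | h
  · have : {x | x ∈ Ioo a b ∧ x - s ∉ Ioo a b} = Ioc a (a + s) := by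
      ext x; simp only [mem_ofPred_eq, mem_Ioo, mem_Ioc, not_and_or, not_lt]; grind
    rw [this, Real.volume_Ioc, min_eq_left (ENNReal.ofReal_le_ofReal h.le)]; congr 1; ring
  · have : {x | x ∈ Ioo a b ∧ x - s ∉ Ioo a b} = Ioo a b := by
      ext x; simp only [mem_ofPred_eq, mem_Ioo, not_and_or, not_lt]; grind
    rw [this, Real.volume_Ioo, min_eq_right (ENNReal.ofReal_le_ofReal h)]

/-- The measure of a planar set is the integral of the lengths of its horizontal slices. -/
lemma volume_eq_lintegral_slices {S : Set Plane} (hS : MeasurableSet S) :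
    volume S = ∫⁻ y : ℝ, volume {a : ℝ | !₂[a, y] ∈ S} := by
  have h1 := (EuclideanSpace.volume_preserving_symm_measurableEquiv_toLp (Fin 2)).symm
  have h2 := (volume_preserving_finTwoArrow ℝ).symm
  have h3 := h1.comp h2
  rw [← h3.measure_preimage hS.nullMeasurableSet, Measure.volume_eq_prod,
    Measure.prod_apply_symm (h3.measurable hS)]
  refine lintegral_congr fun y => ?_
  congr 1

lemma euclidean_norm_sq (a y : ℝ) : ‖(!₂[a, y] : Plane)‖ ^ 2 = a ^ 2 + y ^ 2 := by
  rw [EuclideanSpace.norm_sq_eq]; simp [Fin.sum_univ_two]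

lemma continuous_slice (y : ℝ) : Continuous fun a : ℝ => (!₂[a, y] : Plane) := by
  refine (PiLp.continuous_toLp 2 _).comp ?_
  refine continuous_pi fun i => ?_
  fin_cases i <;> simp <;> fun_prop

lemma convex_slice {E : Set Plane} (hc : Convex ℝ E) (y : ℝ) :
    Convex ℝ {a : ℝ | (!₂[a, y] : Plane) ∈ E} := by
  intro a ha b hb p q hp hq hpq
  have := hc ha hb hp hq hpq
  simp only [mem_ofPred_eq]
  convert this using 1
  ext i
  fin_cases i
  · simp
  · simp [← add_mul, hpq]

lemma isBounded_slice {E : Set Plane} {R : ℝ} (hE : E ⊆ Metric.ball 0 R) (y : ℝ) :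
    Bornology.IsBounded {a : ℝ | (!₂[a, y] : Plane) ∈ E} := by
  refine (Metric.isBounded_closedBall (x := (0 : ℝ)) (r := R)).subset fun a ha => ?_
  have h1 : ‖(!₂[a, y] : Plane)‖ < R := by simpa using hE ha
  have h2 := euclidean_norm_sq a y
  rw [mem_closedBall_zero_iff, Real.norm_eq_abs]
  refine le_trans ?_ h1.le
  exact abs_le_of_sq_le_sq (by nlinarith [sq_nonneg y]) (norm_nonneg _)

lemma measurableSet_loss {E : Set Plane} (hE : MeasurableSet E) (z : Plane) :
    MeasurableSet {x | x ∈ E ∧ x - z ∉ E} :=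
  hE.inter ((measurable_id.sub_const z) hE).compl

lemma translateLoss_horizontal {E : Set Plane} (hc : Convex ℝ E) (ho : IsOpen E) {R : ℝ}
    (hE : E ⊆ Metric.ball 0 R) {s : ℝ} (hs : 0 ≤ s) :
    translateLoss E (s • EuclideanSpace.single 0 1) =
      ∫⁻ y : ℝ, min (ENNReal.ofReal s) (chordLength E y) := by
  rw [translateLoss, volume_eq_lintegral_slices (measurableSet_loss ho.measurableSet _)]
  refine lintegral_congr fun y => ?_
  rw [chordLength, ← volume_translate_diff (convex_slice hc y) (ho.preimage (continuous_slice y))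
    (isBounded_slice hE y) hs]
  congr 1
  ext a
  have : (!₂[a, y] : Plane) - s • EuclideanSpace.single 0 1 = !₂[a - s, y] := by
    ext i; fin_cases i <;> simp
  simp only [mem_ofPred_eq, this]

lemma chordLength_eq_zero {E : Set Plane} {R : ℝ} (hE : E ⊆ Metric.ball 0 R) {y : ℝ}
    (hy : R ≤ |y|) : chordLength E y = 0 := by
  have : {a : ℝ | (!₂[a, y] : Plane) ∈ E} = ∅ := by
    refine eq_empty_of_forall_notMem fun a ha => ?_
    have h1 : ‖(!₂[a, y] : Plane)‖ < R := by simpa using hE ha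
    have h2 := euclidean_norm_sq a y
    have : |y| ≤ ‖(!₂[a, y] : Plane)‖ :=
      abs_le_of_sq_le_sq (by nlinarith [sq_nonneg a]) (norm_nonneg _)
    linarith
  rw [chordLength, this, measure_empty]

lemma le_chordLength {E : Set Plane} {r : ℝ} (hE : Metric.ball 0 r ⊆ E) {y s : ℝ}
    (hr : 0 ≤ r) (h : y ^ 2 + s ^ 2 ≤ r ^ 2) :
    ENNReal.ofReal (2 * s) ≤ chordLength E y := by
  have : Ioo (-s) s ⊆ {a : ℝ | (!₂[a, y] : Plane) ∈ E} := by
    intro a ha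
    apply hE
    rw [mem_ball_zero_iff]
    refine lt_of_pow_lt_pow_left₀ 2 hr ?_
    rw [euclidean_norm_sq]
    nlinarith [ha.1, ha.2]
  refine le_trans (le_of_eq ?_) (measure_mono this)
  rw [Real.volume_Ioo]; congr 1; ring

/-- Long chord: both minima are attained by the shift, and `s = t² (s / t) + (1 - t) s`. -/
lemma min_le_of_le_mul {t s : ℝ} (ht0 : 0 < t) (ht1 : t < 1) (hs : 0 ≤ s) {l : ℝ≥0∞}
    (hl : ENNReal.ofReal (s / t) ≤ l) :
    min (ENNReal.ofReal s) l ≤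
      ENNReal.ofReal (t ^ 2) * min (ENNReal.ofReal (s / t)) l + ENNReal.ofReal ((1 - t) * s) := by
  rw [min_eq_left hl, ← ENNReal.ofReal_mul (by positivity),
    ← ENNReal.ofReal_add (by positivity) (mul_nonneg (by linarith) hs)]
  refine (min_le_left _ _).trans (ENNReal.ofReal_le_ofReal (le_of_eq ?_))
  field_simp; ring

/-- A short chord costs at most a factor `2`, because `1 - t² ≤ 2 (1 - t)`. -/
lemma min_le_general {t s : ℝ} (ht0 : 0 < t) (ht1 : t < 1) (hs : 0 ≤ s) (l : ℝ≥0∞) :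
    min (ENNReal.ofReal s) l ≤
      ENNReal.ofReal (t ^ 2) * min (ENNReal.ofReal (s / t)) l +
        2 * ENNReal.ofReal ((1 - t) * s) := by
  rcases le_total (ENNReal.ofReal (s / t)) l with h | h
  · refine (min_le_of_le_mul ht0 ht1 hs h).trans ?_
    gcongr
    rw [two_mul]; exact le_self_add
  · have hl : l ≠ ∞ := ne_top_of_le_ne_top ENNReal.ofReal_ne_top h
    lift l to NNReal using hl
    rw [min_eq_right h, ← ENNReal.ofReal_coe_nnreal, ← ENNReal.ofReal_min,
      ← ENNReal.ofReal_mul (by positivity), two_mul,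
      ← ENNReal.ofReal_add (mul_nonneg (by linarith) hs) (mul_nonneg (by linarith) hs),
      ← ENNReal.ofReal_add (by positivity)
        (add_nonneg (mul_nonneg (by linarith) hs) (mul_nonneg (by linarith) hs))]
    refine ENNReal.ofReal_le_ofReal ?_
    have hl0 : (0 : ℝ) ≤ l := l.2
    rcases le_total s l with h' | h'
    · rw [min_eq_left h']
      nlinarith [mul_nonneg (sq_nonneg t) (sub_nonneg.2 h'),
        mul_nonneg hs (sq_nonneg (1 - t))]
    · rw [min_eq_right h']
      nlinarith [mul_nonneg hs (sq_nonneg (1 - t)),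
        mul_nonneg (sub_nonneg.2 h') (by nlinarith : (0 : ℝ) ≤ 1 - t ^ 2)]

/-! ### Losses in arbitrary directions and under dilation -/

/-- Every vector of the plane is the image of a horizontal one under a linear isometry. -/
lemma exists_isometry_horizontal (z : Plane) :
    ∃ U : Plane ≃ₗᵢ[ℝ] Plane, U (‖z‖ • EuclideanSpace.single 0 1) = z :=
  -- The reflection across the perpendicular bisector swaps two vectors of equal norm.
  ⟨(ℝ ∙ ((‖z‖ • EuclideanSpace.single 0 1 : Plane) - z))ᗮ.reflection,
    Submodule.reflection_sub (by simp [norm_smul])⟩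

lemma translateLoss_preimage (U : Plane ≃ₗᵢ[ℝ] Plane) (E : Set Plane) (w : Plane) :
    translateLoss (U ⁻¹' E) w = translateLoss E (U w) := by
  rw [translateLoss, translateLoss,
    ← U.measurePreserving.measure_preimage_emb U.toHomeomorph.measurableEmbedding
      {x | x ∈ E ∧ x - U w ∉ E}]
  congr 1
  ext x
  simp

lemma preimage_subset_ball (U : Plane ≃ₗᵢ[ℝ] Plane) {E : Set Plane} {R : ℝ}
    (hE : E ⊆ Metric.ball 0 R) : U ⁻¹' E ⊆ Metric.ball 0 R := by
  intro x hx
  have := hE hx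
  simpa using this

lemma ball_subset_preimage (U : Plane ≃ₗᵢ[ℝ] Plane) {E : Set Plane} {R : ℝ}
    (hE : Metric.ball 0 R ⊆ E) : Metric.ball 0 R ⊆ U ⁻¹' E := by
  intro x hx
  apply hE
  simpa using hx

/-- Each chord loses at most `‖z‖`, and chords exist only at heights in `(-R, R)`. This linear bound
gives finiteness of both perimeters. -/
lemma translateLoss_le {E : Set Plane} (hc : Convex ℝ E) (ho : IsOpen E) {R : ℝ}
    (hE : E ⊆ Metric.ball 0 R) (z : Plane) :
    translateLoss E z ≤ ENNReal.ofReal ‖z‖ * ENNReal.ofReal (2 * R) := by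
  obtain ⟨U, hU⟩ := exists_isometry_horizontal z
  have hcU : Convex ℝ (U ⁻¹' E) := hc.linear_preimage (U : Plane →ₗ[ℝ] Plane)
  have h1 : translateLoss E z = translateLoss E (U (‖z‖ • EuclideanSpace.single 0 1)) := by
    rw [hU]
  rw [h1, ← translateLoss_preimage, translateLoss_horizontal hcU
      (ho.preimage U.continuous) (preimage_subset_ball U hE) (norm_nonneg z)]
  calc _ ≤ ∫⁻ y : ℝ, ENNReal.ofReal ‖z‖ * (Ioo (-R) R).indicator 1 y := by
        refine lintegral_mono fun y => ?_
        by_cases hy : |y| < R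
        · rw [indicator_of_mem (by exact abs_lt.1 hy)]
          simp
        · rw [chordLength_eq_zero (preimage_subset_ball U hE) (not_lt.1 hy)]
          simp
    _ = _ := by
        rw [lintegral_const_mul' _ _ ENNReal.ofReal_ne_top,
          lintegral_indicator_one measurableSet_Ioo, Real.volume_Ioo]
        congr 2; ring

/-- If all chords at heights below `h`, in the direction of `z`, are long, then the loss under
translation by `z` is almost `t` times a rescaled loss. -/
lemma translateLoss_le_scaled_aux {E : Set Plane} (hc : Convex ℝ E) (ho : IsOpen E) {R h t : ℝ}
    (hE : E ⊆ Metric.ball 0 R) (ht0 : 0 < t) (ht1 : t < 1) (h0 : 0 ≤ h) (hR : h ≤ R) (z : Plane)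
    (hchord : ∀ U : Plane ≃ₗᵢ[ℝ] Plane, ∀ y : ℝ, |y| < h →
      ENNReal.ofReal (‖z‖ / t) ≤ chordLength (U ⁻¹' E) y) :
    translateLoss E z ≤ ENNReal.ofReal (t ^ 2) * translateLoss E (t⁻¹ • z) +
      ENNReal.ofReal ((1 - t) * ‖z‖) * ENNReal.ofReal (2 * R + 2 * (R - h)) := by
  obtain ⟨U, hU⟩ := exists_isometry_horizontal z
  have hU' : t⁻¹ • z = U ((‖z‖ / t) • EuclideanSpace.single 0 1) := by
    nth_rewrite 1 [← hU]
    rw [← map_smul, smul_smul, div_eq_inv_mul]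
  have hcU : Convex ℝ (U ⁻¹' E) := hc.linear_preimage (U : Plane →ₗ[ℝ] Plane)
  have hoU := ho.preimage U.continuous
  have hEU := preimage_subset_ball U hE
  have h1 : translateLoss E z = translateLoss E (U (‖z‖ • EuclideanSpace.single 0 1)) := by
    rw [hU]
  rw [h1, hU', ← translateLoss_preimage, ← translateLoss_preimage,
    translateLoss_horizontal hcU hoU hEU (norm_nonneg z),
    translateLoss_horizontal hcU hoU hEU (by positivity)]
  -- Every height in `(-R, R)` pays `(1 - t)‖z‖` once; heights outside `(-h, h)`, where the chord
  -- may be short, pay it a second time.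
  calc _ ≤ ∫⁻ y : ℝ, (ENNReal.ofReal (t ^ 2) *
          min (ENNReal.ofReal (‖z‖ / t)) (chordLength (U ⁻¹' E) y) +
        ENNReal.ofReal ((1 - t) * ‖z‖) * ((Ioo (-R) R).indicator 1 y +
          (Ioo (-R) R \ Ioo (-h) h).indicator 1 y)) := by
        refine lintegral_mono fun y => ?_
        by_cases hy : |y| < R
        · rw [indicator_of_mem (by exact abs_lt.1 hy)]
          by_cases hyh : |y| < h
          · rw [indicator_of_notMem (by simp [abs_lt.1 hyh])]
            simpa using min_le_of_le_mul ht0 ht1 (norm_nonneg z) (hchord U y hyh)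
          · have hmem : y ∈ Ioo (-R) R \ Ioo (-h) h := ⟨abs_lt.1 hy, fun h' => hyh (abs_lt.2 h')⟩
            rw [indicator_of_mem hmem]
            convert min_le_general ht0 ht1 (norm_nonneg z) _ using 2
            simp only [Pi.one_apply, one_add_one_eq_two, mul_comm]
        · rw [chordLength_eq_zero (preimage_subset_ball U hE) (not_lt.1 hy)]
          simp
    _ = _ := by
        have hm : MeasurableSet (Ioo (-R) R \ Ioo (-h) h) :=
          measurableSet_Ioo.diff measurableSet_Ioo
        have h2 : Measurable fun y : ℝ => ENNReal.ofReal ((1 - t) * ‖z‖) *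
            ((Ioo (-R) R).indicator (1 : ℝ → ℝ≥0∞) y +
              (Ioo (-R) R \ Ioo (-h) h).indicator (1 : ℝ → ℝ≥0∞) y) :=
          ((measurable_one.indicator measurableSet_Ioo).add
            (measurable_one.indicator hm)).const_mul _
        rw [lintegral_add_right _ h2,
          lintegral_const_mul' _ _ ENNReal.ofReal_ne_top,
          lintegral_const_mul' _ _ ENNReal.ofReal_ne_top,
          lintegral_add_right _ (measurable_one.indicator hm),
          lintegral_indicator_one measurableSet_Ioo, lintegral_indicator_one hm,
          measure_sdiff (Ioo_subset_Ioo (by linarith) hR) measurableSet_Ioo.nullMeasurableSet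
            (by simp), Real.volume_Ioo, Real.volume_Ioo,
          ← ENNReal.ofReal_sub _ (by linarith), ← ENNReal.ofReal_add (by linarith) (by linarith)]
        congr 3; ring

/-- The case `h = 0`, where no chord need be long; it serves for large `z`. -/
lemma translateLoss_le_scaled {E : Set Plane} (hc : Convex ℝ E) (ho : IsOpen E) {R t : ℝ}
    (hE : E ⊆ Metric.ball 0 R) (ht0 : 0 < t) (ht1 : t < 1) (hR : 0 ≤ R) (z : Plane) :
    translateLoss E z ≤ ENNReal.ofReal (t ^ 2) * translateLoss E (t⁻¹ • z) +
      ENNReal.ofReal ((1 - t) * ‖z‖) * ENNReal.ofReal (4 * R) := by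
  convert translateLoss_le_scaled_aux hc ho hE ht0 ht1 le_rfl hR z
    (fun U y hy => absurd hy (not_lt.2 (abs_nonneg y))) using 4
  ring

/-- By Pythagoras, chords of the inner disk at heights below `h` have half-length at least `s`,
which makes them long relative to `z`. -/
lemma translateLoss_le_scaled_of_small {E : Set Plane} (hc : Convex ℝ E) (ho : IsOpen E)
    {r R h t s : ℝ} (hrE : Metric.ball 0 r ⊆ E) (hE : E ⊆ Metric.ball 0 R) (ht0 : 0 < t)
    (ht1 : t < 1) (hr : 0 ≤ r) (h0 : 0 ≤ h) (hR : h ≤ R) (hs : h ^ 2 + s ^ 2 ≤ r ^ 2) (z : Plane)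
    (hz : ‖z‖ / t ≤ 2 * s) :
    translateLoss E z ≤ ENNReal.ofReal (t ^ 2) * translateLoss E (t⁻¹ • z) +
      ENNReal.ofReal ((1 - t) * ‖z‖) * ENNReal.ofReal (2 * R + 2 * (R - h)) := by
  refine translateLoss_le_scaled_aux hc ho hE ht0 ht1 h0 hR z fun U y hy => ?_
  refine (ENNReal.ofReal_le_ofReal hz).trans (le_chordLength (ball_subset_preimage U hrE) hr ?_)
  have : y ^ 2 ≤ h ^ 2 := sq_le_sq' (by linarith [(abs_lt.1 hy).1]) (abs_lt.1 hy).2.le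
  linarith

lemma translateLoss_smul {t : ℝ} (ht : 0 < t) (E : Set Plane) (z : Plane) :
    translateLoss (t • E) z = ENNReal.ofReal (t ^ 2) * translateLoss E (t⁻¹ • z) := by
  have : {x | x ∈ t • E ∧ x - z ∉ t • E} = t • {x | x ∈ E ∧ x - t⁻¹ • z ∉ E} := by
    ext x
    simp only [mem_ofPred_eq, mem_smul_set_iff_inv_smul_mem₀ ht.ne', smul_sub]
  rw [translateLoss, this, Measure.addHaar_smul, translateLoss]
  simp

/-! ### Nonlocal perimeter as an average of losses -/

/-- The nonlocal perimeter as a weighted integral of the losses under translations. -/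
lemma nonlocalPerimeter_eq {K : Plane → ℝ} (hK : AEMeasurable K) {E : Set Plane}
    (hE : MeasurableSet E) :
    nonlocalPerimeter K E = 2 * ∫⁻ z, ENNReal.ofReal (K z) * translateLoss E z := by
  have hK' : AEMeasurable fun z => ENNReal.ofReal (K z) := hK.ennreal_ofReal
  rw [nonlocalPerimeter]
  congr 1
  calc ∫⁻ x in E, ∫⁻ y in Eᶜ, ENNReal.ofReal (K (x - y))
      = ∫⁻ x, ∫⁻ z, ENNReal.ofReal (K z) * {x | x ∈ E ∧ x - z ∉ E}.indicator 1 x := by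
        rw [← lintegral_indicator hE]
        refine lintegral_congr fun x => ?_
        by_cases hx : x ∈ E
        -- Substitute `y = x - z` at fixed `x`, so that the kernel no longer depends on `x` before
        -- exchanging the integrals.
        · rw [indicator_of_mem hx, ← lintegral_indicator hE.compl,
            ← lintegral_sub_left_eq_self _ x]
          refine lintegral_congr fun z => ?_
          by_cases hz : x - z ∈ E <;> simp [indicator, hx, hz]
        · simp [indicator, hx]
    _ = ∫⁻ z, ∫⁻ x, ENNReal.ofReal (K z) * {x | x ∈ E ∧ x - z ∉ E}.indicator 1 x := by
        refine lintegral_lintegral_swap ?_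
        refine hK'.comp_snd.mul (Measurable.aemeasurable ?_)
        have hm : MeasurableSet {p : Plane × Plane | p.1 ∈ E ∧ p.1 - p.2 ∉ E} :=
          (measurable_fst hE).inter ((measurable_fst.sub measurable_snd) hE).compl
        have := (measurable_one (α := ℝ≥0∞)).indicator hm
        exact this
    _ = _ := by
        refine lintegral_congr fun z => ?_
        rw [lintegral_const_mul' _ _ ENNReal.ofReal_ne_top,
          lintegral_indicator_one (measurableSet_loss hE z), translateLoss]

/-! ### The constant `K_{1,2}` -/

lemma integral_mul_exp_neg_sq_Ioi : ∫ x in Ioi (0 : ℝ), x * Real.exp (-x ^ 2) = 1 / 2 := by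
  have h := integral_rpow_mul_exp_neg_rpow (p := 2) (q := 1) (by norm_num) (by norm_num)
  norm_num at h
  rw [← h]

lemma integral_sq_mul_exp_neg_sq_Ioi :
    ∫ x in Ioi (0 : ℝ), x * (x * Real.exp (-x ^ 2)) = √Real.pi / 4 := by
  have h := integral_rpow_mul_exp_neg_rpow (p := 2) (q := 2) (by norm_num) (by norm_num)
  have e : ((2 : ℝ) + 1) / 2 = 1 / 2 + 1 := by norm_num
  rw [e, Real.Gamma_add_one (by norm_num), Real.Gamma_one_half_eq] at h
  norm_num at h
  rw [show √Real.pi / 4 = 1 / 2 * (1 / 2 * √Real.pi) by ring, ← h]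
  refine integral_congr_ae (Eventually.of_forall fun x => ?_)
  simp only []; ring

lemma integral_abs_mul_exp_neg_sq : ∫ x : ℝ, |x| * Real.exp (-x ^ 2) = 1 := by
  have h := integral_comp_abs (f := fun x : ℝ => x * Real.exp (-x ^ 2))
  simp only [sq_abs] at h
  rw [h, integral_mul_exp_neg_sq_Ioi]; norm_num

/-- Integrals over the plane of products of a radial and an angular factor. -/
lemma integral_polar_mul (u : Plane → ℝ) (h : ℝ → ℝ) (f : Plane → ℝ)
    (hf : ∀ (σ : Metric.sphere (0 : Plane) 1) (r : ℝ), 0 < r → f (r • (σ : Plane)) = u σ * h r) :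
    ∫ x : Plane, f x = (∫ σ : Metric.sphere (0 : Plane) 1, u σ ∂(volume : Measure Plane).toSphere) *
      ∫ r : Ioi (0 : ℝ), h r ∂(Measure.volumeIoiPow (Module.finrank ℝ Plane - 1)) := by
  calc
    ∫ x, f x = ∫ x : ({(0)}ᶜ : Set Plane), f x.1 ∂((volume : Measure Plane).comap (↑)) := by
      rw [integral_subtype_comap (measurableSet_singleton _).compl fun x ↦ f x,
        restrict_compl_singleton]
    _ = ∫ x : Metric.sphere (0 : Plane) 1 × Ioi (0 : ℝ), u x.1 * h x.2
          ∂(volume : Measure Plane).toSphere.prod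
            (.volumeIoiPow (Module.finrank ℝ Plane - 1)) := by
      rw [← (volume : Measure Plane).measurePreserving_homeomorphUnitSphereProd.integral_comp
        (Homeomorph.measurableEmbedding _)]
      refine integral_congr_ae (Eventually.of_forall fun x => ?_)
      have hx : 0 < ‖(x : Plane)‖ := norm_pos_iff.2 x.2
      have := hf (homeomorphUnitSphereProd Plane x).1 ‖(x : Plane)‖ hx
      simp only [homeomorphUnitSphereProd_apply_fst_coe,
        homeomorphUnitSphereProd_apply_snd_coe] at this ⊢
      rw [← this, smul_smul, mul_inv_cancel₀ hx.ne', one_smul]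
    _ = _ := integral_prod_mul (fun σ : Metric.sphere (0 : Plane) 1 => u σ)
        (fun r : Ioi (0 : ℝ) => h r)

lemma integral_abs_fst_mul_exp :
    ∫ x : Plane, |x 0| * Real.exp (-‖x‖ ^ 2) = √Real.pi := by
  have h1 := (EuclideanSpace.volume_preserving_symm_measurableEquiv_toLp (Fin 2)).symm
  have h2 := (volume_preserving_finTwoArrow ℝ).symm
  have h3 := h1.comp h2
  rw [← h3.integral_comp
    ((MeasurableEquiv.measurableEmbedding _).comp (MeasurableEquiv.measurableEmbedding _))]
  have : ∀ p : ℝ × ℝ, (fun x : Plane => |x 0| * Real.exp (-‖x‖ ^ 2))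
      ((⇑(MeasurableEquiv.toLp 2 (Fin 2 → ℝ)).symm.symm ∘ ⇑MeasurableEquiv.finTwoArrow.symm) p) =
      (|p.1| * Real.exp (-p.1 ^ 2)) * Real.exp (-p.2 ^ 2) := by
    intro p
    have : ((⇑(MeasurableEquiv.toLp 2 (Fin 2 → ℝ)).symm.symm ∘
      ⇑MeasurableEquiv.finTwoArrow.symm) p) = (!₂[p.1, p.2] : Plane) := rfl
    simp only [this]
    rw [EuclideanSpace.norm_sq_eq]
    simp [Fin.sum_univ_two, Real.exp_add]
    ring
  simp only [this]
  rw [Measure.volume_eq_prod, integral_prod_mul (fun a : ℝ => |a| * Real.exp (-a ^ 2))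
    (fun b : ℝ => Real.exp (-b ^ 2)), integral_abs_mul_exp_neg_sq, one_mul]
  simpa using integral_gaussian 1

/-- The Gaussian integrals of `|x 0|` and of `‖x‖` have the same radial factor in polar coordinates.
The second determines that factor as `√π / 4`; the first, computed in Cartesian coordinates, then
gives `4` for the integral of `|σ 0|` over a circle of length `2π`. -/
lemma meanAbsProjection_eq : meanAbsProjection = 2 / Real.pi := by
  have hA := integral_polar_mul (fun x => |x 0|) (fun r => r * Real.exp (-r ^ 2))
    (fun x => |x 0| * Real.exp (-‖x‖ ^ 2)) (by
      intro σ r hr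
      have : ‖(σ : Plane)‖ = 1 := by simp
      simp [norm_smul, abs_mul, abs_of_pos hr, this]
      ring)
  have hB := integral_polar_mul (fun x => 1) (fun r => r * Real.exp (-r ^ 2))
    (fun x => ‖x‖ * Real.exp (-‖x‖ ^ 2)) (by
      intro σ r hr
      have : ‖(σ : Plane)‖ = 1 := by simp
      simp [norm_smul, abs_of_pos hr, this])
  have hvol : (volume : Measure Plane).real (Metric.ball 0 1) = Real.pi := by
    simp [measureReal_def, EuclideanSpace.volume_ball_fin_two, Real.pi_pos.le]
  rw [integral_fun_norm_addHaar volume (fun r => r * Real.exp (-r ^ 2)), hvol] at hB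
  simp only [finrank_euclideanSpace, Fintype.card_fin, Nat.add_one_sub_one, pow_one, smul_eq_mul,
    nsmul_eq_mul, integral_sq_mul_exp_neg_sq_Ioi] at hB
  rw [integral_abs_fst_mul_exp] at hA
  simp only [integral_const, smul_eq_mul, mul_one, Measure.toSphere_real_apply_univ, hvol,
    finrank_euclideanSpace, Fintype.card_fin] at hB hA
  rw [meanAbsProjection, average_eq, Measure.toSphere_real_apply_univ, hvol]
  simp only [EuclideanSpace.inner_single_right, finrank_euclideanSpace, Fintype.card_fin]
  have hp := Real.pi_pos
  have hs : 0 < √Real.pi := Real.sqrt_pos.2 hp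
  push_cast at hB hA ⊢
  set C := ∫ r : Ioi (0 : ℝ), (r : ℝ) * Real.exp (-(r : ℝ) ^ 2) ∂Measure.volumeIoiPow (2 - 1)
  have hC : C = √Real.pi / 4 := by
    have : (2 * Real.pi) * C = (2 * Real.pi) * (√Real.pi / 4) := by linarith
    exact mul_left_cancel₀ (by positivity) this
  rw [hC] at hA
  simp at hA ⊢
  have hI : ∫ σ : Metric.sphere (0 : Plane) 1, |(σ : Plane).ofLp 0|
      ∂(volume : Measure Plane).toSphere = 4 := by
    have : √Real.pi * 4 = √Real.pi * ∫ σ : Metric.sphere (0 : Plane) 1, |(σ : Plane).ofLp 0|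
      ∂(volume : Measure Plane).toSphere := by linarith
    exact (mul_left_cancel₀ hs.ne' this).symm
  rw [hI]
  field_simp
  norm_num

/-! ### Local perimeter: scaling, lower bound, finiteness -/

lemma perimeter_congr {E F : Set Plane} (h : E =ᵐ[volume] F) : perimeter E = perimeter F := by
  simp only [perimeter, setIntegral_congr_set h]

lemma le_perimeter {E : Set Plane} {φ : Plane → Plane} (h1 : ContDiff ℝ 1 φ)
    (h2 : HasCompactSupport φ) (h3 : ∀ x, ‖φ x‖ ≤ 1) :
    ENNReal.ofReal (∫ x in E, divergence φ x) ≤ perimeter E :=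
  le_iSup_of_le φ (le_iSup_of_le h1 (le_iSup_of_le h2 (le_iSup_of_le h3 le_rfl)))

/-- A test field `φ` for `t • E` pulls back to the test field `φ (t • ·)` for `E`; the chain rule
gives a factor `t` and the change of variables `t⁻²`. -/
lemma perimeter_smul_le {t : ℝ} (ht : 0 < t) (E : Set Plane) :
    perimeter (t • E) ≤ ENNReal.ofReal t * perimeter E := by
  refine iSup_le fun φ => iSup_le fun h1 => iSup_le fun h2 => iSup_le fun h3 => ?_
  have hdiv : ∀ x, divergence (fun x => φ (t • x)) x = t * divergence φ (t • x) := by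
    intro x
    have hd : HasFDerivAt (fun x : Plane => φ (t • x))
        ((fderiv ℝ φ (t • x)).comp (t • ContinuousLinearMap.id ℝ Plane)) x :=
      ((h1.differentiable one_ne_zero (t • x)).hasFDerivAt).comp x
        ((ContinuousLinearMap.id ℝ Plane).hasFDerivAt.const_smul t)
    simp only [divergence, hd.fderiv, Finset.mul_sum]
    refine Finset.sum_congr rfl fun i _ => ?_
    simp
  have hle := le_perimeter (E := E) (φ := fun x => φ (t • x))
    (h1.comp (contDiff_id.const_smul t))
    (h2.comp_homeomorph (Homeomorph.smulOfNeZero t ht.ne')) (fun x => h3 _)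
  simp only [hdiv, integral_const_mul] at hle
  rw [Measure.setIntegral_comp_smul volume (divergence φ) E ht.ne'] at hle
  refine le_trans (le_of_eq ?_) (mul_le_mul_right hle (ENNReal.ofReal t))
  rw [← ENNReal.ofReal_mul ht.le]
  congr 1
  simp only [finrank_euclideanSpace, Fintype.card_fin, smul_eq_mul, abs_inv,
    abs_of_pos (pow_pos ht 2)]
  field_simp

/-- Test with `x / R'`, cut off smoothly between radii `R` and `R'`: its norm is at most `1`, its
divergence on `E` is `2 / R'`, and `E` has area at least `π r²`. -/
lemma le_perimeter_of_ball_subset {E : Set Plane} (ho : IsOpen E) {r R R' : ℝ} (hr : 0 ≤ r)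
    (hR : 0 < R) (hR' : R < R') (hrE : Metric.ball 0 r ⊆ E) (hE : E ⊆ Metric.ball 0 R) :
    ENNReal.ofReal (2 * Real.pi * r ^ 2 / R') ≤ perimeter E := by
  let f : ContDiffBump (0 : Plane) := ⟨R, R', hR, hR'⟩
  have hR'0 : 0 < R' := hR.trans hR'
  let φ : Plane → Plane := fun x => (f x / R') • x
  have h1 : ContDiff ℝ 1 φ := (f.contDiff.div_const _).smul contDiff_id
  have h2 : HasCompactSupport φ := by
    refine f.hasCompactSupport.mono fun x hx => ?_
    rw [Function.mem_support] at hx ⊢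
    intro h
    exact hx (by simp [φ, h])
  have h3 : ∀ x, ‖φ x‖ ≤ 1 := by
    intro x
    by_cases hx : ‖x‖ < R'
    · simp only [φ, norm_smul, norm_div, Real.norm_eq_abs, abs_of_pos hR'0, abs_of_nonneg f.nonneg]
      rw [div_mul_eq_mul_div, div_le_one hR'0]
      nlinarith [f.le_one (x := x), f.nonneg (x := x), norm_nonneg x]
    · have : f x = 0 := f.zero_of_le_dist (by simpa using hx)
      simp [φ, this]
  have hdiv : ∀ x ∈ E, divergence φ x = 2 / R' := by
    intro x hx
    have hev : φ =ᶠ[𝓝 x] fun x => R'⁻¹ • x := by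
      filter_upwards [f.eventuallyEq_one_of_mem_ball (hE hx)] with y hy
      simp only [φ, hy, Pi.one_apply, one_div]
    have hd : HasFDerivAt φ (R'⁻¹ • ContinuousLinearMap.id ℝ Plane) x :=
      ((ContinuousLinearMap.id ℝ Plane).hasFDerivAt.const_smul R'⁻¹).congr_of_eventuallyEq hev
    rw [divergence, hd.fderiv]
    simp
    ring
  refine le_trans (ENNReal.ofReal_le_ofReal ?_) (le_perimeter h1 h2 h3)
  rw [setIntegral_congr_fun ho.measurableSet hdiv, setIntegral_const, smul_eq_mul]
  have hfin : volume E ≠ ∞ := ne_top_of_le_ne_top measure_ball_lt_top.ne (measure_mono hE)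
  have hv : Real.pi * r ^ 2 ≤ volume.real E := by
    have := measureReal_mono hrE hfin
    simp only [measureReal_def, EuclideanSpace.volume_ball_fin_two, ENNReal.toReal_mul,
      ENNReal.toReal_pow, ENNReal.toReal_ofReal hr, ENNReal.toReal_ofReal Real.pi_pos.le] at this
    rw [measureReal_def]
    linarith
  rw [mul_assoc, mul_comm 2, mul_div_assoc]
  gcongr

/-- Integration by parts against the indicator of a bounded set, in finite difference form. -/
lemma abs_setIntegral_sub_translate_le {E : Set Plane} (hE : MeasurableSet E)
    {ψ : Plane → ℝ} (hψ : Integrable ψ) (hψ1 : ∀ x, |ψ x| ≤ 1) {C : ℝ} (hC : 0 ≤ C)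
    (hloss : ∀ z, translateLoss E z ≤ ENNReal.ofReal ‖z‖ * ENNReal.ofReal C) (z : Plane) :
    |∫ x in E, (ψ (x + z) - ψ x)| ≤ 2 * C * ‖z‖ := by
  have hψz : Integrable fun x => ψ (x + z) := hψ.comp_add_right z
  rw [integral_sub hψz.integrableOn hψ.integrableOn, ← integral_indicator hE,
    ← integral_indicator hE]
  -- Moving the translation from `ψ` to the indicator leaves an integrand supported where exactly
  -- one of `x`, `x - z` lies in `E`.
  have e1 : ∫ x, E.indicator (fun x => ψ (x + z)) x = ∫ x, E.indicator (fun x => ψ (x + z)) (x - z) :=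
    (integral_sub_right_eq_self _ z).symm
  have i1 : Integrable fun x => E.indicator (fun x => ψ (x + z)) (x - z) :=
    (hψz.indicator hE).comp_sub_right z
  rw [e1, ← integral_sub i1 (hψ.indicator hE)]
  set A : Set Plane := {x | x ∈ E ∧ x - z ∉ E}
  set B : Set Plane := {x | x - z ∈ E ∧ x ∉ E}
  have hA : volume A ≤ ENNReal.ofReal ‖z‖ * ENNReal.ofReal C := hloss z
  have hB : volume B ≤ ENNReal.ofReal ‖z‖ * ENNReal.ofReal C := by
    have : B = (fun x => x - z) ⁻¹' {x | x ∈ E ∧ x - (-z) ∉ E} := by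
      ext x; simp [B]
    rw [this, (measurePreserving_sub_right volume z).measure_preimage
      (measurableSet_loss hE _).nullMeasurableSet]
    simpa [translateLoss] using hloss (-z)
  have hAB : volume (A ∪ B) ≤ ENNReal.ofReal (2 * C * ‖z‖) := by
    refine (measure_union_le _ _).trans ((add_le_add hA hB).trans (le_of_eq ?_))
    rw [← ENNReal.ofReal_mul (norm_nonneg z), ← ENNReal.ofReal_add (by positivity) (by positivity)]
    congr 1; ring
  rw [← setIntegral_eq_integral_of_forall_compl_eq_zero (s := A ∪ B)]
  · rw [← Real.norm_eq_abs]
    refine (norm_setIntegral_le_of_norm_le_const (C := 1)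
      (hAB.trans_lt ENNReal.ofReal_lt_top) fun x _ => ?_).trans ?_
    · by_cases h1 : x ∈ E <;> by_cases h2 : x - z ∈ E <;> simp [h1, h2, hψ1 x]
    · rw [one_mul, measureReal_def]
      exact ENNReal.toReal_le_of_le_ofReal (by positivity) hAB
  · intro x hx
    by_cases h1 : x ∈ E <;> by_cases h2 : x - z ∈ E <;> simp [h1, h2, A, B] at hx ⊢

/-- Difference quotients of `ψ` obey the bound uniformly, and pass to the limit by dominated
convergence since `ψ` is Lipschitz. -/
lemma abs_setIntegral_fderiv_le {E : Set Plane} (hE : MeasurableSet E) (hfin : volume E ≠ ∞)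
    {ψ : Plane → ℝ} (hψ : ContDiff ℝ 1 ψ) (hψc : HasCompactSupport ψ) (hψ1 : ∀ x, |ψ x| ≤ 1)
    {C : ℝ} (hC : 0 ≤ C)
    (hloss : ∀ z, translateLoss E z ≤ ENNReal.ofReal ‖z‖ * ENNReal.ofReal C) (v : Plane) :
    |∫ x in E, fderiv ℝ ψ x v| ≤ 2 * C * ‖v‖ := by
  obtain ⟨L, hL⟩ := hψ.lipschitzWith_of_hasCompactSupport hψc one_ne_zero
  have hψi : Integrable ψ := hψ.continuous.integrable_of_hasCompactSupport hψc
  have hlim : Tendsto (fun n : ℕ => ∫ x in E, ((n : ℝ) + 1) *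
      (ψ (x + ((n : ℝ) + 1)⁻¹ • v) - ψ x)) atTop (𝓝 (∫ x in E, fderiv ℝ ψ x v)) := by
    refine tendsto_integral_of_dominated_convergence (fun _ => L * ‖v‖) (fun n => ?_) ?_
      (fun n => Eventually.of_forall fun x => ?_) (Eventually.of_forall fun x => ?_)
    · have := hψ.continuous
      exact (by fun_prop : Continuous fun x => ((n : ℝ) + 1) *
        (ψ (x + ((n : ℝ) + 1)⁻¹ • v) - ψ x)).aestronglyMeasurable
    · exact integrableOn_const hfin
    · have hn : (0 : ℝ) < n + 1 := by positivity
      have := hL.dist_le_mul (x + ((n : ℝ) + 1)⁻¹ • v) x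
      rw [dist_eq_norm, dist_eq_norm, add_sub_cancel_left, norm_smul, norm_inv,
        Real.norm_of_nonneg hn.le] at this
      rw [norm_mul, Real.norm_of_nonneg hn.le]
      calc _ ≤ ((n : ℝ) + 1) * (L * (((n : ℝ) + 1)⁻¹ * ‖v‖)) := by gcongr
        _ = _ := by field_simp
    · have hd := (hψ.differentiable one_ne_zero x).hasFDerivAt
      have hc : Tendsto (fun n : ℕ => ‖(n : ℝ) + 1‖) atTop atTop :=
        tendsto_norm_atTop_atTop.comp (tendsto_natCast_atTop_atTop.atTop_add tendsto_const_nhds)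
      simpa using hd.lim v hc
  refine le_of_tendsto hlim.abs (Eventually.of_forall fun n => ?_)
  have hn : (0 : ℝ) < n + 1 := by positivity
  rw [integral_const_mul, abs_mul, abs_of_pos hn]
  calc _ ≤ ((n : ℝ) + 1) * (2 * C * ‖((n : ℝ) + 1)⁻¹ • v‖) := by
        gcongr
        exact abs_setIntegral_sub_translate_le hE hψi hψ1 hC hloss _
    _ = _ := by
        rw [norm_smul, norm_inv, Real.norm_of_nonneg hn.le]; field_simp

/-- A loss linear in `‖z‖` forces bounded variation; the divergence is handled one component at a
time. -/
lemma perimeter_ne_top {E : Set Plane} (hE : MeasurableSet E) (hfin : volume E ≠ ∞)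
    {C : ℝ} (hC : 0 ≤ C)
    (hloss : ∀ z, translateLoss E z ≤ ENNReal.ofReal ‖z‖ * ENNReal.ofReal C) :
    perimeter E ≠ ∞ := by
  refine ne_top_of_le_ne_top (ENNReal.ofReal_ne_top (r := 2 * (2 * C))) ?_
  refine iSup_le fun φ => iSup_le fun h1 => iSup_le fun h2 => iSup_le fun h3 =>
    ENNReal.ofReal_le_ofReal ?_
  have hcomp : ∀ i : Fin 2, ContDiff ℝ 1 fun x => φ x i := fun i =>
    (EuclideanSpace.proj (𝕜 := ℝ) i).contDiff.comp h1
  have hsupp : ∀ i : Fin 2, HasCompactSupport fun x => φ x i := fun i =>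
    h2.comp_left (g := fun x : Plane => x i) rfl
  have hdiv : ∀ x, divergence φ x =
      ∑ i : Fin 2, fderiv ℝ (fun x => φ x i) x (EuclideanSpace.single i 1) := by
    intro x
    refine Finset.sum_congr rfl fun i _ => ?_
    have hd : HasFDerivAt (fun x => φ x i)
        ((EuclideanSpace.proj (𝕜 := ℝ) i).comp (fderiv ℝ φ x)) x :=
      (EuclideanSpace.proj (𝕜 := ℝ) i).hasFDerivAt.comp x
        (h1.differentiable one_ne_zero x).hasFDerivAt
    rw [hd.fderiv]; rfl
  simp only [hdiv]
  rw [integral_finsetSum]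
  · calc _ ≤ ∑ i : Fin 2, 2 * C := by
          refine Finset.sum_le_sum fun i _ => (le_abs_self _).trans ?_
          refine (abs_setIntegral_fderiv_le hE hfin (hcomp i) (hsupp i) (fun x => ?_) hC hloss
            _).trans (le_of_eq (by simp))
          exact (PiLp.norm_apply_le (φ x) i).trans (h3 x)
      _ = _ := by simp
  · intro i _
    refine Integrable.integrableOn ?_
    refine Continuous.integrable_of_hasCompactSupport ?_ ((hsupp i).fderiv_apply (𝕜 := ℝ) _)
    exact ((hcomp i).continuous_fderiv one_ne_zero).clm_apply continuous_const

/-! ### Moments of the kernel and finiteness of the nonlocal perimeter -/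

lemma nonlocalPerimeter_congr {K : Plane → ℝ} {E F : Set Plane} (h : E =ᵐ[volume] F) :
    nonlocalPerimeter K E = nonlocalPerimeter K F := by
  simp only [nonlocalPerimeter, Measure.restrict_congr_set h,
    Measure.restrict_congr_set h.compl]

/-- Divide the integrable moment by `‖x‖`; the origin is null. -/
lemma IsAdmissibleKernel.aemeasurable {G : Plane → ℝ} (hG : IsAdmissibleKernel G) :
    AEMeasurable G := by
  have h1 : AEMeasurable fun x : Plane => ‖x‖⁻¹ * (‖x‖ * G x) :=
    (measurable_norm.inv.aemeasurable).mul hG.integrable_moment.aestronglyMeasurable.aemeasurable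
  refine h1.congr ?_
  filter_upwards [compl_mem_ae_iff.2 (measure_singleton (0 : Plane))] with x hx
  have : ‖x‖ ≠ 0 := norm_ne_zero_iff.2 hx
  field_simp

lemma aemeasurable_rescaledKernel {G : Plane → ℝ} (hG : AEMeasurable G) {ε : ℝ} (hε : 0 < ε) :
    AEMeasurable (rescaledKernel G ε) :=
  (hG.comp_quasiMeasurePreserving
    (Measure.quasiMeasurePreserving_smul volume (inv_ne_zero hε.ne'))).const_mul _

/-- The first moment of `G` outside the ball of radius `ρ`. -/
def tailMoment (G : Plane → ℝ) (ρ : ℝ) : ℝ :=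
  ∫ x in {x : Plane | ρ < ‖x‖}, ‖x‖ * G x

lemma measurableSet_lt_norm (ρ : ℝ) : MeasurableSet {x : Plane | ρ < ‖x‖} :=
  measurableSet_lt measurable_const measurable_norm

lemma tendsto_tailMoment {G : Plane → ℝ} (hG : Integrable fun x : Plane => ‖x‖ * G x) :
    Tendsto (tailMoment G) atTop (𝓝 0) := by
  have h := tendsto_setIntegral_of_antitone (μ := volume) (s := fun ρ : ℝ => {x : Plane | ρ < ‖x‖})
    measurableSet_lt_norm (fun a b hab x (hx : b < ‖x‖) => lt_of_le_of_lt hab hx)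
    ⟨0, hG.integrableOn⟩
  have he : ⋂ ρ : ℝ, {x : Plane | ρ < ‖x‖} = ∅ := by
    refine eq_empty_of_forall_notMem fun x hx => ?_
    have h' : ‖x‖ < ‖x‖ := mem_iInter.1 hx ‖x‖
    exact lt_irrefl _ h'
  rw [he, setIntegral_empty] at h
  exact h

/-- The factor `ε⁻³` is the one that preserves the first moment in the plane, so rescaling only
moves the threshold from `s` to `s / ε`. -/
lemma setLIntegral_rescaledKernel {G : Plane → ℝ} (hG : IsAdmissibleKernel G) {ε : ℝ}
    (hε : 0 < ε) (s : ℝ) :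
    ∫⁻ z in {z : Plane | s < ‖z‖}, ENNReal.ofReal (rescaledKernel G ε z) * ENNReal.ofReal ‖z‖ =
      ENNReal.ofReal (tailMoment G (s / ε)) := by
  set f : Plane → ℝ := {x : Plane | s / ε < ‖x‖}.indicator fun x => ‖x‖ * G x
  have hf : Integrable f := hG.integrable_moment.indicator (measurableSet_lt_norm _)
  have hf0 : ∀ x, 0 ≤ f x :=
    indicator_nonneg fun x _ => mul_nonneg (norm_nonneg x) (hG.nonneg x)
  have hfε : Integrable fun x : Plane => (ε ^ 2)⁻¹ * f (ε⁻¹ • x) :=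
    (hf.comp_smul (inv_ne_zero hε.ne')).const_mul _
  have key : ∀ z : Plane, {z : Plane | s < ‖z‖}.indicator
      (fun z => ENNReal.ofReal (rescaledKernel G ε z) * ENNReal.ofReal ‖z‖) z =
        ENNReal.ofReal ((ε ^ 2)⁻¹ * f (ε⁻¹ • z)) := by
    intro z
    have hn : ‖ε⁻¹ • z‖ = ‖z‖ / ε := by
      rw [norm_smul, norm_inv, Real.norm_of_nonneg hε.le, div_eq_inv_mul]
    by_cases hz : s < ‖z‖
    · have hz' : s / ε < ‖ε⁻¹ • z‖ := by rw [hn]; gcongr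
      rw [indicator_of_mem (by exact hz)]
      simp only [f]
      rw [indicator_of_mem (by exact hz'),
        ← ENNReal.ofReal_mul' (norm_nonneg z), hn, rescaledKernel]
      congr 1
      field_simp
    · have hz' : ¬ s / ε < ‖ε⁻¹ • z‖ := by
        rw [hn]; exact fun h => hz ((div_lt_div_iff_of_pos_right hε).1 h)
      rw [indicator_of_notMem (by exact hz)]
      simp only [f]
      rw [indicator_of_notMem (by exact hz')]
      simp
  rw [← lintegral_indicator (measurableSet_lt_norm s), lintegral_congr key,
    ← ofReal_integral_eq_lintegral_ofReal hfε
      (Eventually.of_forall fun x => mul_nonneg (by positivity) (hf0 _)),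
    integral_const_mul, Measure.integral_comp_smul, tailMoment,
    ← integral_indicator (measurableSet_lt_norm _)]
  congr 1
  simp only [finrank_euclideanSpace, Fintype.card_fin, smul_eq_mul, inv_pow, inv_inv,
    abs_of_pos (pow_pos hε 2)]
  rw [inv_mul_cancel_left₀ (pow_ne_zero 2 hε.ne')]

lemma lintegral_rescaledKernel {G : Plane → ℝ} (hG : IsAdmissibleKernel G) {ε : ℝ} (hε : 0 < ε) :
    ∫⁻ z, ENNReal.ofReal (rescaledKernel G ε z) * ENNReal.ofReal ‖z‖ =
      ENNReal.ofReal (Real.pi / 2) := by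
  -- A negative threshold makes both truncated domains the whole plane.
  have h := setLIntegral_rescaledKernel hG hε (-1)
  have h1 : {z : Plane | -1 < ‖z‖} = univ :=
    eq_univ_of_forall fun z => (by norm_num : (-1 : ℝ) < 0).trans_le (norm_nonneg z)
  have h2 : {z : Plane | -1 / ε < ‖z‖} = univ :=
    eq_univ_of_forall fun z =>
      (div_neg_of_neg_of_pos (by norm_num : (-1 : ℝ) < 0) hε).trans_le (norm_nonneg z)
  rw [h1, tailMoment, h2, setLIntegral_univ, setIntegral_univ, hG.moment_eq,
    meanAbsProjection_eq] at h
  rw [h, one_div_div]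

lemma nonlocalPerimeter_ne_top {G : Plane → ℝ} (hG : IsAdmissibleKernel G) {ε : ℝ} (hε : 0 < ε)
    {E : Set Plane} (hE : MeasurableSet E) {C : ℝ}
    (hloss : ∀ z, translateLoss E z ≤ ENNReal.ofReal ‖z‖ * ENNReal.ofReal C) :
    nonlocalPerimeter (rescaledKernel G ε) E ≠ ∞ := by
  rw [nonlocalPerimeter_eq (aemeasurable_rescaledKernel hG.aemeasurable hε) hE]
  refine ENNReal.mul_ne_top (by simp) ?_
  refine ne_top_of_le_ne_top
    (ENNReal.mul_ne_top (ENNReal.ofReal_ne_top (r := Real.pi / 2)) (ENNReal.ofReal_ne_top (r := C))) ?_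
  rw [← lintegral_rescaledKernel hG hε, ← lintegral_mul_const' _ _ ENNReal.ofReal_ne_top]
  refine lintegral_mono fun z => ?_
  rw [mul_assoc]
  exact mul_le_mul_right (hloss z) _

/-! ### Comparison of energies -/

/-- Shrinking a convex set close to a ball decreases its nonlocal perimeter at most by an amount
close to `2 π (1 - t)`. -/
lemma nonlocalPerimeter_le_smul {G : Plane → ℝ} (hG : IsAdmissibleKernel G) {ε : ℝ} (hε : 0 < ε)
    {E : Set Plane} (hc : Convex ℝ E) (ho : IsOpen E) {r R h s t : ℝ}
    (hrE : Metric.ball 0 r ⊆ E) (hE : E ⊆ Metric.ball 0 R) (ht0 : 1 / 2 < t) (ht1 : t < 1)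
    (hr : 0 ≤ r) (h0 : 0 ≤ h) (hR : h ≤ R) (hs0 : 0 ≤ s) (hs : h ^ 2 + s ^ 2 ≤ r ^ 2) :
    nonlocalPerimeter (rescaledKernel G ε) E ≤
      nonlocalPerimeter (rescaledKernel G ε) (t • E) +
        ENNReal.ofReal (2 * (1 - t) * ((2 * R + 2 * (R - h)) * (Real.pi / 2) +
          4 * R * tailMoment G (s / ε))) := by
  have ht : 0 < t := by linarith
  have hK := aemeasurable_rescaledKernel hG.aemeasurable hε
  have hKm : AEMeasurable fun z =>
      ENNReal.ofReal (rescaledKernel G ε z) * ENNReal.ofReal ‖z‖ :=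
    hK.ennreal_ofReal.mul measurable_norm.ennreal_ofReal.aemeasurable
  have htail : 0 ≤ tailMoment G (s / ε) :=
    setIntegral_nonneg (measurableSet_lt_norm _) fun x _ =>
      mul_nonneg (norm_nonneg x) (hG.nonneg x)
  rw [nonlocalPerimeter_eq hK ho.measurableSet,
    nonlocalPerimeter_eq hK (ho.smul₀ ht.ne').measurableSet]
  set k : Plane → ℝ≥0∞ := fun z => ENNReal.ofReal (rescaledKernel G ε z) * ENNReal.ofReal ‖z‖
  set c₁ : ℝ := 2 * R + 2 * (R - h)
  have hc₁ : 0 ≤ c₁ := by simp only [c₁]; linarith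
  have hbound : ∀ z, ENNReal.ofReal (rescaledKernel G ε z) * translateLoss E z ≤
      ENNReal.ofReal (rescaledKernel G ε z) * translateLoss (t • E) z +
        (ENNReal.ofReal ((1 - t) * c₁) * k z +
          ENNReal.ofReal ((1 - t) * (4 * R)) * {z : Plane | s < ‖z‖}.indicator k z) := by
    intro z
    rw [translateLoss_smul ht]
    have e : ∀ c : ℝ, ENNReal.ofReal ((1 - t) * c) * k z =
        ENNReal.ofReal (rescaledKernel G ε z) *
          (ENNReal.ofReal ((1 - t) * ‖z‖) * ENNReal.ofReal c) := by
      intro c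
      rw [ENNReal.ofReal_mul (by linarith), ENNReal.ofReal_mul (by linarith)]
      ring
    -- Large shifts use the crude constant `4R`, charged to the tail moment; small ones use the
    -- sharp constant `c₁`.
    by_cases hz : s < ‖z‖
    · rw [indicator_of_mem (by exact hz), e (4 * R)]
      refine (mul_le_mul_right (translateLoss_le_scaled hc ho hE ht ht1 (h0.trans hR) z) _).trans ?_
      rw [mul_add]
      gcongr
      exact le_add_self
    · rw [indicator_of_notMem (by exact hz), e c₁, mul_zero, add_zero, ← mul_add]
      refine mul_le_mul_right (translateLoss_le_scaled_of_small hc ho hrE hE ht ht1 hr h0 hR hs z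
        ?_) _
      -- Here `t > 1/2` enters: `‖z‖ ≤ s ≤ 2 * s * t`.
      rw [div_le_iff₀ ht]
      nlinarith
  calc _ ≤ 2 * ∫⁻ z, (ENNReal.ofReal (rescaledKernel G ε z) * translateLoss (t • E) z +
        (ENNReal.ofReal ((1 - t) * c₁) * k z +
          ENNReal.ofReal ((1 - t) * (4 * R)) * {z : Plane | s < ‖z‖}.indicator k z)) := by
        gcongr with z
        exact hbound z
    _ = _ := by
        have hm1 : AEMeasurable fun z => ENNReal.ofReal ((1 - t) * c₁) * k z := hKm.const_mul _
        have hm2 : AEMeasurable fun z =>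
            ENNReal.ofReal ((1 - t) * (4 * R)) * {z : Plane | s < ‖z‖}.indicator k z :=
          (hKm.indicator (measurableSet_lt_norm s)).const_mul _
        have hm3 : AEMeasurable fun z => ENNReal.ofReal ((1 - t) * c₁) * k z +
            ENNReal.ofReal ((1 - t) * (4 * R)) * {z : Plane | s < ‖z‖}.indicator k z := hm1.add hm2
        rw [lintegral_add_right' _ hm3, lintegral_add_right' _ hm2,
          lintegral_const_mul' _ _ ENNReal.ofReal_ne_top,
          lintegral_const_mul' _ _ ENNReal.ofReal_ne_top,
          lintegral_indicator (measurableSet_lt_norm s), setLIntegral_rescaledKernel hG hε,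
          lintegral_rescaledKernel hG hε, mul_add]
        congr 1
        have h1t : 0 ≤ 1 - t := by linarith
        have hR0 : 0 ≤ 4 * R := by linarith
        have hp := Real.pi_pos
        rw [← ENNReal.ofReal_mul (by positivity), ← ENNReal.ofReal_mul (by positivity),
          ← ENNReal.ofReal_add (by positivity) (by positivity),
          show (2 : ℝ≥0∞) = ENNReal.ofReal 2 by simp, ← ENNReal.ofReal_mul (by norm_num)]
        congr 1; ring

/-- At `κ = 0` the inequality reads `2πγ < 2π`, and both sides are continuous. The single parameter
`κ` governs the outer radius `1 + κ`, inner radius `1 - κ/2`, chord height `1 - κ`, cutoff radius `1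
+ 2κ` and the tail bound. -/
lemma exists_margin {γ : ℝ} (hγ₁ : γ < 1) :
    ∃ κ : ℝ, 0 < κ ∧ κ < 1 / 2 ∧
      γ * (2 * ((2 * (1 + κ) + 2 * ((1 + κ) - (1 - κ))) * (Real.pi / 2) + 4 * (1 + κ) * κ)) <
        2 * Real.pi * (1 - κ / 2) ^ 2 / (1 + 2 * κ) := by
  have hl : ContinuousAt (fun κ : ℝ => γ * (2 * ((2 * (1 + κ) + 2 * ((1 + κ) - (1 - κ))) *
      (Real.pi / 2) + 4 * (1 + κ) * κ))) 0 := by fun_prop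
  have hr : ContinuousAt (fun κ : ℝ => 2 * Real.pi * (1 - κ / 2) ^ 2 / (1 + 2 * κ)) 0 :=
    ContinuousAt.div (by fun_prop) (by fun_prop) (by norm_num)
  have hlt := (hl.eventually_lt hr (by norm_num; nlinarith [Real.pi_pos])).filter_mono
    (nhdsWithin_le_nhds (s := Ioi 0))
  have hev : ∀ᶠ κ in 𝓝[>] (0 : ℝ), κ < 1 / 2 :=
    nhdsWithin_le_nhds (Iio_mem_nhds (by norm_num))
  obtain ⟨κ, h1, h2, h3⟩ :=
    (hlt.and (hev.and self_mem_nhdsWithin)).exists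
  exact ⟨κ, h3, h2, h1⟩

/-- The comparison of energies for open convex sets. -/
lemma energy_smul_lt_of_isOpen {G : Plane → ℝ} (hG : IsAdmissibleKernel G) {γ : ℝ} (hγ₀ : 0 < γ)
    {κ : ℝ} (hκ0 : 0 < κ) (hκ1 : κ < 1 / 2)
    (hκ : γ * (2 * ((2 * (1 + κ) + 2 * ((1 + κ) - (1 - κ))) * (Real.pi / 2) + 4 * (1 + κ) * κ)) <
        2 * Real.pi * (1 - κ / 2) ^ 2 / (1 + 2 * κ))
    {ε : ℝ} (hε : 0 < ε) (htail : tailMoment G (κ / 2 / ε) < κ)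
    {E : Set Plane} (hc : Convex ℝ E) (ho : IsOpen E)
    (hrE : Metric.ball 0 (1 - κ / 2) ⊆ E) (hE : E ⊆ Metric.ball 0 (1 + κ)) :
    perimeter E ≠ ∞ ∧ nonlocalPerimeter (rescaledKernel G ε) E ≠ ∞ ∧
      ∀ t : ℝ, t ∈ Ioo (1 / 2 : ℝ) 1 →
        perimeter (t • E) ≠ ∞ ∧ nonlocalPerimeter (rescaledKernel G ε) (t • E) ≠ ∞ ∧
        energy G γ ε (t • E) < energy G γ ε E := by
  have hfin : volume E ≠ ∞ := ne_top_of_le_ne_top measure_ball_lt_top.ne (measure_mono hE)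
  have hP : perimeter E ≠ ∞ :=
    perimeter_ne_top ho.measurableSet hfin (by positivity) (translateLoss_le hc ho hE)
  have hQ : nonlocalPerimeter (rescaledKernel G ε) E ≠ ∞ :=
    nonlocalPerimeter_ne_top hG hε ho.measurableSet (translateLoss_le hc ho hE)
  refine ⟨hP, hQ, fun t ⟨ht0, ht1⟩ => ?_⟩
  have ht : 0 < t := by linarith
  have hPt' := perimeter_smul_le ht E
  have hPt : perimeter (t • E) ≠ ∞ :=
    ne_top_of_le_ne_top (ENNReal.mul_ne_top ENNReal.ofReal_ne_top hP) hPt'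
  have htE : t • E ⊆ Metric.ball 0 (1 + κ) := by
    rintro _ ⟨x, hx, rfl⟩
    have h1 : ‖x‖ < 1 + κ := by simpa using hE hx
    have : ‖t • x‖ < 1 + κ := by
      rw [norm_smul, Real.norm_of_nonneg ht.le]
      nlinarith [norm_nonneg x]
    simpa using this
  have hQt : nonlocalPerimeter (rescaledKernel G ε) (t • E) ≠ ∞ :=
    nonlocalPerimeter_ne_top hG hε (ho.smul₀ ht.ne').measurableSet
      (translateLoss_le (hc.smul t) (ho.smul₀ ht.ne') htE)
  refine ⟨hPt, hQt, ?_⟩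
  have hlow := le_perimeter_of_ball_subset ho (r := 1 - κ / 2) (R' := 1 + 2 * κ) (by linarith)
    (by linarith) (by linarith) hrE hE
  -- The Pythagorean condition `(1 - κ)² + (κ/2)² ≤ (1 - κ/2)²` amounts to `κ² ≤ κ`.
  have hdrop := nonlocalPerimeter_le_smul hG hε hc ho (h := 1 - κ) (s := κ / 2) hrE hE ht0 ht1
    (by linarith) (by linarith) (by linarith) (by linarith) (by nlinarith)
  have htail0 : 0 ≤ tailMoment G (κ / 2 / ε) :=
    setIntegral_nonneg (measurableSet_lt_norm _) fun x _ =>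
      mul_nonneg (norm_nonneg x) (hG.nonneg x)
  set c : ℝ := (2 * (1 + κ) + 2 * ((1 + κ) - (1 - κ))) * (Real.pi / 2) +
    4 * (1 + κ) * tailMoment G (κ / 2 / ε) with hcdef
  have hc0 : 0 ≤ c := by
    have := Real.pi_pos
    have : 0 ≤ (1 + κ) - (1 - κ) := by linarith
    positivity
  have hclt : γ * (2 * c) < 2 * Real.pi * (1 - κ / 2) ^ 2 / (1 + 2 * κ) := by
    refine lt_of_le_of_lt ?_ hκ
    rw [hcdef]
    gcongr
  have h1 : (perimeter (t • E)).toReal ≤ t * (perimeter E).toReal := by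
    have := ENNReal.toReal_mono (ENNReal.mul_ne_top ENNReal.ofReal_ne_top hP) hPt'
    rwa [ENNReal.toReal_mul, ENNReal.toReal_ofReal ht.le] at this
  have h2 : 2 * Real.pi * (1 - κ / 2) ^ 2 / (1 + 2 * κ) ≤ (perimeter E).toReal :=
    (ENNReal.ofReal_le_iff_le_toReal hP).1 hlow
  have h3 : (nonlocalPerimeter (rescaledKernel G ε) E).toReal ≤
      (nonlocalPerimeter (rescaledKernel G ε) (t • E)).toReal + 2 * (1 - t) * c := by
    have := ENNReal.toReal_mono (ENNReal.add_ne_top.2 ⟨hQt, ENNReal.ofReal_ne_top⟩) hdrop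
    rwa [ENNReal.toReal_add hQt ENNReal.ofReal_ne_top, ENNReal.toReal_ofReal
      (mul_nonneg (by linarith) hc0)] at this
  have h4 : (1 - t) * (γ * (2 * c)) < (1 - t) * (perimeter E).toReal :=
    mul_lt_mul_of_pos_left (hclt.trans_le h2) (by linarith)
  have h5 := mul_le_mul_of_nonneg_left h3 hγ₀.le
  simp only [energy]
  nlinarith

lemma interior_ae_eq_of_convex {E : Set Plane} (hc : Convex ℝ E) : interior E =ᵐ[volume] E :=
  interior_ae_eq_of_null_frontier (hc.addHaar_frontier volume)

end LiquidDrop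

end

theorem mainTheorem7 (G : LiquidDrop.Plane → ℝ) (hG : LiquidDrop.IsAdmissibleKernel G)
    (γ : ℝ) (hγ₀ : 0 < γ) (hγ₁ : γ < 1)
    (δ : ℝ → ℝ) (hδ : Tendsto δ (𝓝[>] 0) (𝓝 0)) :
    ∃ ε₁ : ℝ, 0 < ε₁ ∧ ∀ ε : ℝ, 0 < ε → ε < ε₁ →
      ∀ E : Set LiquidDrop.Plane, Convex ℝ E →
        Metric.ball 0 (1 - δ ε) ⊆ E → E ⊆ Metric.ball 0 (1 + δ ε) →
        LiquidDrop.perimeter E ≠ ∞ ∧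
        LiquidDrop.nonlocalPerimeter (LiquidDrop.rescaledKernel G ε) E ≠ ∞ ∧
        ∀ t : ℝ, t ∈ Ioo (1 / 2 : ℝ) 1 →
          LiquidDrop.perimeter (t • E) ≠ ∞ ∧
          LiquidDrop.nonlocalPerimeter (LiquidDrop.rescaledKernel G ε) (t • E) ≠ ∞ ∧
          LiquidDrop.energy G γ ε (t • E) < LiquidDrop.energy G γ ε E := by
  obtain ⟨κ, hκ0, hκ1, hκ⟩ := LiquidDrop.exists_margin hγ₁
  have hδκ : ∀ᶠ ε in 𝓝[>] (0 : ℝ), δ ε < κ / 2 := hδ.eventually_lt_const (by linarith)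
  have hinv : Tendsto (fun ε : ℝ => κ / 2 / ε) (𝓝[>] 0) atTop := by
    simpa only [div_eq_mul_inv] using
      tendsto_inv_nhdsGT_zero.const_mul_atTop (by linarith : 0 < κ / 2)
  have htail : ∀ᶠ ε in 𝓝[>] (0 : ℝ), LiquidDrop.tailMoment G (κ / 2 / ε) < κ :=
    ((LiquidDrop.tendsto_tailMoment hG.integrable_moment).comp hinv).eventually_lt_const hκ0
  obtain ⟨ε₁, hε₁, hsub⟩ := mem_nhdsGT_iff_exists_Ioo_subset.1 (hδκ.and htail)
  refine ⟨ε₁, hε₁, fun ε hε hεε₁ E hc hrE hE => ?_⟩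
  obtain ⟨h1, h2⟩ := hsub ⟨hε, hεε₁⟩
  -- A convex set has null frontier and both perimeters ignore null sets, so `E` may be replaced by
  -- its interior.
  have hint := LiquidDrop.interior_ae_eq_of_convex hc
  have hrE' : Metric.ball 0 (1 - κ / 2) ⊆ interior E :=
    interior_maximal ((Metric.ball_subset_ball (by linarith)).trans hrE) Metric.isOpen_ball
  have hE' : interior E ⊆ Metric.ball 0 (1 + κ) :=
    (interior_subset.trans hE).trans (Metric.ball_subset_ball (by linarith))
  have main := LiquidDrop.energy_smul_lt_of_isOpen hG hγ₀ hκ0 hκ1 hκ hε h2 hc.interior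
    isOpen_interior hrE' hE'
  simp only [LiquidDrop.energy] at main ⊢
  rw [LiquidDrop.perimeter_congr hint, LiquidDrop.nonlocalPerimeter_congr hint] at main
  refine ⟨main.1, main.2.1, fun t ht => ?_⟩
  have hint' : t • interior E =ᵐ[volume] t • E := by
    have ht0 : t ≠ 0 := by linarith [ht.1]
    rw [← interior_smul₀ ht0]
    exact LiquidDrop.interior_ae_eq_of_convex (hc.smul t)
  have := main.2.2 t ht
  rwa [LiquidDrop.perimeter_congr hint', LiquidDrop.nonlocalPerimeter_congr hint'] at this
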